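/- Let $\mathfrak c=|\mathbb R|$, and let "perfect set" mean a nonempty closed subset of $\mathbb C$ without isolated points. Let $\mathcal G$ be the set of all functions $f:\mathbb C\to\mathbb C$ such that: (a) $f$ is strongly everywhere surjective, i.e. for every nonempty open $U\subset\mathbb C$ and every $z\in\mathbb C$ the set $\{x\in U: f(x)=z\}$ has cardinality $\mathfrak c$; (b) every perfect set $S\subset\mathbb C$ contains a perfect set $S'\subset S$ with $f|_{S'}=0$; (c) $f$ is Lebesgue measurable, and $f$ has the Baire property (the preimage of every open set differs from an open set by a meager set). Every function $f:\mathbb C\to\mathbb C$ satisfying (b), hence every $f\in\mathcal G$, is $s(\mathbb C)$-measurable, i.e. the preimage under $f$ of every Borel set belongs to the Marczewski $\sigma$-algebra $s(\mathbb C)$ of all $A\subset\mathbb C$ such that every perfect set $P$ contains a perfect set $Q$ with $Q\subset A\cap P$ or $Q\subset P\setminus A$. Moreover, $\mathcal G$ is strongly $2^{\mathfrak c}$-algebrable in the complex algebra $\mathbb C^{\mathbb C}$ of all functions $\mathbb C\to\mathbb C$ with pointwise operations: there is a set $X\subset\mathbb C^{\mathbb C}$ of cardinality $2^{\mathfrak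 c}$ such that $P(f_1,\dots,f_n)\neq 0$ for all $n\ge 1$, all distinct $f_1,\dots,f_n\in X$ and every nonzero complex polynomial $P$ in $n$ variables without constant term, and such that the (not necessarily unital) subalgebra generated by $X$ is contained in $\mathcal G\cup\{0\}$. -/

import Mathlib

open scoped Cardinal

/-- A set `X` in a commutative `𝕜`-algebra freely generates the (non-unital) algebra it generates:
no nonzero polynomial without constant term vanishes at distinct elements of `X`. -/
def FreelyGenerates (𝕜 : Type*) {A : Type*} [Field 𝕜] [CommRing A] [Algebra 𝕜 A]
    (X : Set A) : Prop :=
  ∀ P : MvPolynomial X 𝕜, MvPolynomial.constantCoeff P = 0 →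
    MvPolynomial.aeval (fun x : X => (x : A)) P = 0 → P = 0

/-- `E` is strongly `κ`-algebrable: `E ∪ {0}` contains a free (commutative, not necessarily
unital) algebra with `κ` free generators. -/
def StronglyAlgebrable (𝕜 : Type*) {A : Type*} [Field 𝕜] [CommRing A] [Algebra 𝕜 A]
    (κ : Cardinal) (E : Set A) : Prop :=
  ∃ X : Set A, #X = κ ∧ FreelyGenerates 𝕜 X ∧
    (NonUnitalAlgebra.adjoin 𝕜 X : Set A) ⊆ E ∪ {0}

/-- Every value is taken continuum many times on every nonempty open set. -/
def StronglyEverywhereSurjective (f : ℂ → ℂ) : Prop :=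
  ∀ U : Set ℂ, IsOpen U → U.Nonempty → ∀ z : ℂ, #{x : ℂ | x ∈ U ∧ f x = z} = 𝔠

/-- Every nonempty perfect set contains a nonempty perfect set on which `f` vanishes. -/
def VanishesPerfectly (f : ℂ → ℂ) : Prop :=
  ∀ S : Set ℂ, Perfect S → S.Nonempty →
    ∃ S' : Set ℂ, S' ⊆ S ∧ Perfect S' ∧ S'.Nonempty ∧ ∀ x ∈ S', f x = 0

/-- Membership in the Marczewski σ-algebra of a topological space. -/
def MarczewskiSet {X : Type*} [TopologicalSpace X] (A : Set X) : Prop :=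
  ∀ P : Set X, Perfect P → P.Nonempty →
    ∃ Q : Set X, Q ⊆ P ∧ Perfect Q ∧ Q.Nonempty ∧ (Q ⊆ A ∩ P ∨ Q ⊆ P \ A)

/-- Measurability with respect to the Marczewski σ-algebra: preimages of Borel sets
belong to it. -/
def MarczewskiMeasurable (f : ℂ → ℂ) : Prop :=
  ∀ B : Set ℂ, MeasurableSet B → MarczewskiSet (f ⁻¹' B)

/-- Preimages of open sets have the property of Baire. -/
def HasBaireProperty (f : ℂ → ℂ) : Prop :=
  ∀ U : Set ℂ, IsOpen U → BaireMeasurableSet (f ⁻¹' U)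

/-- The class `𝒢`. Being null-measurable for `volume` is Lebesgue measurability: preimages of
Borel sets are measurable for the completion of the Lebesgue measure on the Borel sets. -/
def classG : Set (ℂ → ℂ) :=
  {f | StronglyEverywhereSurjective f ∧ VanishesPerfectly f ∧
    MeasureTheory.NullMeasurable f MeasureTheory.volume ∧ HasBaireProperty f}

/-! Every function used vanishes off one set of points `z i` with Liouville real part and
non-Liouville imaginary part. Liouville numbers are null and residual, so this support is null and
meager, which gives (c). A transfinite choice of length `𝔠` makes it thin enough for (b), while each
of `𝔠` labels still occurs `𝔠` times in every open set (`exists_thin_labelled_points`). The values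
depend only on the labels, through an independent family of `2 ^ 𝔠` functions: some label gives any
finitely many members prescribed values. As a nonzero polynomial over `ℂ` without constant term
takes every value, so does its value on the family at some label, hence `𝔠` times in each open set.
Having no constant term keeps it zero off the support. Freeness follows because functions in the
class are nonzero. -/

open Set

/-- A function with `VanishesPerfectly` is measurable for the Marczewski σ-algebra. -/
theorem VanishesPerfectly.marczewskiMeasurable {f : ℂ → ℂ} (hf : VanishesPerfectly f) :
    MarczewskiMeasurable f := by
  intro B _ P hP hne
  obtain ⟨Q, hQP, hQ, hQne, hQ0⟩ := hf P hP hne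
  refine ⟨Q, hQP, hQ, hQne, ?_⟩
  by_cases h0 : (0 : ℂ) ∈ B
  · exact Or.inl fun x hx => ⟨by simpa [hQ0 x hx] using h0, hQP hx⟩
  · exact Or.inr fun x hx => ⟨hQP hx, by simpa [hQ0 x hx] using h0⟩

/-! ### Cardinalities of sets of reals -/

/-- Turns uncountability, obtained below by category or measure, into cardinality `𝔠` without the
continuum hypothesis. -/
theorem MeasurableSet.mk_eq_continuum {s : Set ℝ} (hs : MeasurableSet s) (hc : ¬ s.Countable) :
    #s = 𝔠 := by
  have := hs.standardBorel
  have h : ¬ Countable s := hc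
  rw [← Cardinal.mk_real]
  exact Cardinal.mk_congr
    (PolishSpace.measurableEquivOfNotCountable h (not_countable (α := ℝ))).toEquiv

theorem mk_liouville_inter_eq_continuum {I : Set ℝ} (hI : IsOpen I) (hne : I.Nonempty) :
    #({x | Liouville x} ∩ I : Set ℝ) = 𝔠 := by
  refine MeasurableSet.mk_eq_continuum
    (IsGδ.setOfPred_liouville.measurableSet.inter hI.measurableSet) ?_
  intro hc
  have h1 : ({x | Liouville x} ∩ I : Set ℝ)ᶜ ∈ residual ℝ :=
    residual_of_dense_Gδ hc.isGδ_compl (hc.dense_compl ℝ)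
  obtain ⟨x, hx, hxI⟩ := (dense_of_mem_residual
    (Filter.inter_mem h1 eventually_residual_liouville)).inter_open_nonempty I hI hne
  exact hxI.1 ⟨hxI.2, hx⟩

theorem mk_not_liouville_inter_eq_continuum {J : Set ℝ} (hJ : IsOpen J) (hne : J.Nonempty) :
    #({x | ¬ Liouville x} ∩ J : Set ℝ) = 𝔠 := by
  refine MeasurableSet.mk_eq_continuum
    (IsGδ.setOfPred_liouville.measurableSet.compl.inter hJ.measurableSet) ?_
  intro hc
  have h1 : MeasureTheory.volume J ≠ 0 := (hJ.measure_pos _ hne).ne'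
  apply h1
  refine MeasureTheory.measure_mono_null (t := ({x | ¬ Liouville x} ∩ J) ∪ {x | Liouville x}) ?_
    (MeasureTheory.measure_union_null (hc.measure_zero _) volume_setOfPred_liouville)
  intro x hx
  by_cases h : Liouville x
  exacts [Or.inr h, Or.inl ⟨h, hx⟩]

theorem exists_mem_notMem_of_mk_lt {α : Type*} {s t : Set α} (h : #t < #s) : ∃ x ∈ s, x ∉ t := by
  by_contra! hst
  exact h.not_ge (Cardinal.mk_le_mk_of_subset hst)

/-! ### Perfect sets -/

/-- A perfect set contains continuum many pairwise disjoint perfect sets, so one of them avoids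
any set which has fewer than continuum many points in it. -/
theorem Perfect.exists_subset_disjoint {P A : Set ℂ} (hP : Perfect P) (hne : P.Nonempty)
    (hA : #(A ∩ P : Set ℂ) < 𝔠) :
    ∃ Q ⊆ P, Perfect Q ∧ Q.Nonempty ∧ Disjoint Q A := by
  obtain ⟨f, hfP, hfc, hfi⟩ := hP.exists_nat_bool_injection hne
  -- Interleaving even and odd coordinates splits a Cantor set into `𝔠` disjoint uncountable compact
  -- slices `g a`.
  let e : (ℕ → Bool) × (ℕ → Bool) → (ℕ → Bool) := fun p n =>
    if n % 2 = 0 then p.1 (n / 2) else p.2 (n / 2)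
  have hec : Continuous e := by
    refine continuous_pi fun n => ?_
    by_cases h : n % 2 = 0 <;> simp only [e, h, if_true, if_false] <;> fun_prop
  have hei : Function.Injective e := by
    rintro ⟨a, b⟩ ⟨c, d⟩ h
    ext n
    · simpa [e] using congrFun h (2 * n)
    · have := congrFun h (2 * n + 1)
      have h2 : (2 * n + 1) / 2 = n := by omega
      simpa [e, h2] using this
  let g : (ℕ → Bool) → Set ℂ := fun a => range fun b => f (e (a, b))
  have hgP : ∀ a, g a ⊆ P := fun a => by
    rintro _ ⟨b, rfl⟩
    exact hfP (mem_range_self _)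
  obtain ⟨a, ha⟩ : ∃ a, Disjoint (g a) A := by
    by_contra! h
    choose y hy hyA using fun a => not_disjoint_iff.1 (h a)
    have hinj : Function.Injective fun a => (⟨y a, hyA a, hgP a (hy a)⟩ : (A ∩ P : Set ℂ)) := by
      intro a a' haa
      obtain ⟨b, hb⟩ := hy a
      obtain ⟨b', hb'⟩ := hy a'
      have h3 : y a = y a' := congrArg Subtype.val haa
      rw [← hb, ← hb'] at h3
      exact congrArg Prod.fst (hei (hfi h3))
    have := Cardinal.mk_le_of_injective hinj
    simp only [Cardinal.mk_pi, Cardinal.mk_bool, Cardinal.prod_const, Cardinal.lift_id,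
      Cardinal.mk_nat] at this
    rw [Cardinal.two_power_aleph0] at this
    exact hA.not_ge this
  have hcl : IsClosed (g a) := (isCompact_range (by fun_prop)).isClosed
  have hunc : ¬ (g a).Countable := by
    intro hc
    have hi : Function.Injective fun b => f (e (a, b)) := fun b b' h =>
      congrArg Prod.snd (hei (hfi h))
    have : Countable (ℕ → Bool) := by
      rw [← countable_univ_iff]
      exact (countable_of_injective_of_countable_image hi.injOn (by rwa [image_univ]))
    have h2 := Cardinal.mk_le_aleph0_iff.2 this
    simp only [Cardinal.mk_pi, Cardinal.mk_bool, Cardinal.prod_const, Cardinal.lift_id,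
      Cardinal.mk_nat, Cardinal.two_power_aleph0] at h2
    exact h2.not_gt Cardinal.aleph0_lt_continuum
  obtain ⟨Q, hQ, hQne, hQg⟩ := exists_perfect_nonempty_of_isClosed_of_not_countable hcl hunc
  exact ⟨Q, hQg.trans (hgP a), hQ, hQne, ha.mono_left hQg⟩

/-! ### Polynomials and independent families of functions -/

/-- A nonzero polynomial without constant term over an algebraically closed field takes every
value. -/
theorem MvPolynomial.exists_eval_eq_of_constantCoeff_eq_zero {K σ : Type*} [Field K] [IsAlgClosed K]
    {P : MvPolynomial σ K} (h0 : constantCoeff P = 0) (hP : P ≠ 0) (v : K) :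
    ∃ a : σ → K, eval a P = v := by
  have : Infinite K := IsAlgClosed.instInfinite
  obtain ⟨b, hb⟩ : ∃ b : σ → K, eval b P ≠ 0 := by
    by_contra! h
    exact hP (MvPolynomial.funext fun b => by simp [h b])
  -- Restriction of `P` to the line through `0` and `b`; it differs at `0` and `1`, so `q - v` is
  -- nonconstant and has a root.
  let q : Polynomial K := aeval (fun i => Polynomial.C (b i) * Polynomial.X) P
  have hq : ∀ s : K, q.eval s = eval (fun i => b i * s) P := by
    intro s
    have : q.eval s = (Polynomial.aeval s) q := by simp [Polynomial.aeval_def, Polynomial.eval₂_id]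
    rw [this]
    simp only [q]
    rw [← AlgHom.comp_apply, comp_aeval, ← aeval_eq_eval]
    simp
  have hq0 : q.eval 0 = 0 := by
    rw [hq, show (fun i => b i * 0) = (0 : σ → K) from _root_.funext fun i => mul_zero _, eval_zero]
    exact h0
  have hq1 : q.eval 1 ≠ 0 := by simpa [hq] using hb
  have hdeg : (q - Polynomial.C v).degree ≠ 0 := by
    intro h
    have hc := Polynomial.eq_C_of_degree_eq_zero h
    have h01 : (q - Polynomial.C v).eval 0 = (q - Polynomial.C v).eval 1 := by
      rw [hc]
      simp
    apply hq1
    simpa [hq0] using h01.symm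
  obtain ⟨s, hs⟩ := IsAlgClosed.exists_root _ hdeg
  refine ⟨_, (hq s).symm.trans ?_⟩
  simpa [sub_eq_zero] using hs

/-- The data at which an independent family of functions, indexed by sets of reals, is evaluated:
a finite set separating finitely many sets of reals, and prescribed values on its subsets. -/
abbrev SeparatingData : Type := Finset ℝ × (Finset ℝ →₀ ℂ)

theorem mk_separatingData : #SeparatingData = 𝔠 := by
  simp [SeparatingData, Cardinal.mk_prod, Cardinal.mk_real]

open Classical in
/-- The independent family: evaluate the prescribed values at the trace of `A`. -/
noncomputable def independentFamily (A : Set ℝ) (t : SeparatingData) : ℂ :=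
  t.2 (t.1.filter (· ∈ A))

/-- Any values can be prescribed for finitely many members of the independent family. -/
theorem exists_independentFamily_eq (s : Finset (Set ℝ)) (a : Set ℝ → ℂ) :
    ∃ t, ∀ A ∈ s, independentFamily A t = a A := by
  classical
  have hsep : ∀ p : Set ℝ × Set ℝ, ∃ x : ℝ, p.1 ≠ p.2 → ¬ (x ∈ p.1 ↔ x ∈ p.2) := by
    intro p
    by_contra! h
    exact (h 0).1 (Set.ext fun x => (h x).2)
  choose x hx using hsep
  -- One separating point for each pair makes the traces on `F` of the members of `s` distinct.
  let F : Finset ℝ := (s ×ˢ s).image x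
  have hinj : InjOn (fun A : Set ℝ => F.filter (· ∈ A)) s := by
    intro A hA B hB hAB
    by_contra hne
    refine hx (A, B) hne ?_
    have hF : x (A, B) ∈ F := Finset.mem_image_of_mem _ (Finset.mk_mem_product hA hB)
    have := congrArg (x (A, B) ∈ ·) hAB
    simpa [hF] using this
  refine ⟨(F, ∑ A ∈ s, Finsupp.single (F.filter (· ∈ A)) (a A)), fun A hA => ?_⟩
  simp only [independentFamily, Finsupp.finsetSum_apply]
  rw [Finset.sum_eq_single A]
  · simp
  · intro B hB hBA
    exact Finsupp.single_eq_of_ne fun h => hBA (hinj hB hA h.symm)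
  · exact fun h => absurd hA h

/-- Nonzero polynomials without constant term in the independent family take every value. -/
theorem exists_eval_independentFamily_eq {P : MvPolynomial (Set ℝ) ℂ}
    (h0 : MvPolynomial.constantCoeff P = 0) (hP : P ≠ 0) (v : ℂ) :
    ∃ t, MvPolynomial.eval (fun A => independentFamily A t) P = v := by
  obtain ⟨a, rfl⟩ := MvPolynomial.exists_eval_eq_of_constantCoeff_eq_zero h0 hP v
  obtain ⟨t, ht⟩ := exists_independentFamily_eq P.vars a
  exact ⟨t, MvPolynomial.eval₂Hom_congr' rfl (fun A hA _ => ht A hA) rfl⟩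

/-! ### A thin set of support -/

/-- Every nonempty open set of the plane has a point with Liouville real part and non-Liouville
imaginary part, off fewer than continuum many vertical lines and fewer than continuum many sets
with countable vertical sections. -/
theorem exists_mem_open_avoiding {U : Set ℂ} (hU : IsOpen U) (hne : U.Nonempty) {κ : Type}
    (hκ : #κ < 𝔠) {B : Set ℝ} (hB : #B < 𝔠) {G : κ → Set ℂ}
    (hG : ∀ j x, {y : ℝ | (⟨x, y⟩ : ℂ) ∈ G j}.Countable) :
    ∃ z ∈ U, Liouville z.re ∧ ¬ Liouville z.im ∧ z.re ∉ B ∧ ∀ j, z ∉ G j := by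
  obtain ⟨w, hw⟩ := hne
  have hx := mk_liouville_inter_eq_continuum (Complex.isOpenMap_re U hU) ⟨_, mem_image_of_mem _ hw⟩
  obtain ⟨x, ⟨hxL, u, huU, hux⟩, hxB⟩ := exists_mem_notMem_of_mk_lt (hB.trans_eq hx.symm)
  have hopen : IsOpen {y : ℝ | (⟨x, y⟩ : ℂ) ∈ U} := by
    have : Continuous fun y : ℝ => (⟨x, y⟩ : ℂ) := by
      simp_rw [Complex.mk_eq_add_mul_I]
      fun_prop
    exact hU.preimage this
  have hy := mk_not_liouville_inter_eq_continuum hopen ⟨u.im, by subst hux; exact huU⟩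
  have hsmall : #(⋃ j, {y : ℝ | (⟨x, y⟩ : ℂ) ∈ G j} : Set ℝ) < 𝔠 := by
    refine (Cardinal.mk_iUnion_le _).trans_lt ?_
    refine Cardinal.mul_lt_of_lt Cardinal.aleph0_le_continuum hκ ?_
    refine lt_of_le_of_lt (ciSup_le' fun j => ?_) Cardinal.aleph0_lt_continuum
    exact Cardinal.mk_le_aleph0_iff.2 (hG j x)
  obtain ⟨y, ⟨hyL, hyU⟩, hyG⟩ := exists_mem_notMem_of_mk_lt (hsmall.trans_eq hy.symm)
  refine ⟨⟨x, y⟩, hyU, hxL, hyL, hxB, fun j hj => hyG (mem_iUnion.2 ⟨j, hj⟩)⟩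

/-- Transfinite choice of points subject to a condition involving the earlier points. -/
theorem exists_forall_of_wellFoundedLT {ι α : Type*} [LinearOrder ι] [WellFoundedLT ι]
    (R : (i : ι) → (Iio i → α) → α → Prop) (h : ∀ i g, ∃ z, R i g z) :
    ∃ z : ι → α, ∀ i, R i (fun j => z j) (z i) := by
  choose c hc using h
  let z : ι → α := (wellFounded_lt (α := ι)).fix fun i g => c i fun j => g j j.2
  refine ⟨z, fun i => ?_⟩
  have : z i = c i fun j => z j := (wellFounded_lt (α := ι)).fix_eq _ i
  rw [this]
  exact hc _ _

theorem mk_opens_complex : #(TopologicalSpace.Opens ℂ) ≤ 𝔠 := by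
  have h : #{s : Set ℂ | MeasurableSet s} ≤ 𝔠 := by
    obtain ⟨b, hb, hgen⟩ := MeasurableSpace.CountablyGenerated.isCountablyGenerated (α := ℂ)
    rw [hgen]
    exact MeasurableSpace.cardinal_measurableSet_le_continuum
      ((Cardinal.mk_le_aleph0_iff.2 hb).trans Cardinal.aleph0_le_continuum)
  refine le_trans (Cardinal.mk_le_of_injective
    (f := fun U : TopologicalSpace.Opens ℂ =>
      (⟨U, U.isOpen.measurableSet⟩ : {s : Set ℂ | MeasurableSet s})) ?_) h
  intro U V hUV
  exact TopologicalSpace.Opens.ext (congrArg Subtype.val hUV)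

/-- A family of labelled points of the plane, with every label occurring continuum many times in
every nonempty open set, but so thin that every perfect set contains a perfect set avoiding it. -/
theorem exists_thin_labelled_points {T : Type} [Nonempty T] (hT : #T ≤ 𝔠) :
    ∃ (ι : Type) (z : ι → ℂ) (τ : ι → T), Function.Injective z ∧
      (∀ i, Liouville (z i).re ∧ ¬ Liouville (z i).im) ∧
      (∀ U : Set ℂ, IsOpen U → U.Nonempty → ∀ t, 𝔠 ≤ #{i | z i ∈ U ∧ τ i = t}) ∧
      ∀ P : Set ℂ, Perfect P → P.Nonempty →
        ∃ Q ⊆ P, Perfect Q ∧ Q.Nonempty ∧ Disjoint Q (range z) := by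
  let ι : Type := (𝔠 : Cardinal.{0}).ord.ToType
  have hι : #ι = 𝔠 := by simp [ι]
  -- The factor `ℝ` repeats each pair of open set and label `𝔠` times.
  have hprod : #(TopologicalSpace.Opens ℂ × T × ℝ) = 𝔠 := by
    simp only [Cardinal.mk_prod, Cardinal.lift_id, Cardinal.mk_real]
    rw [Cardinal.mul_eq_right Cardinal.aleph0_le_continuum hT (Cardinal.mk_ne_zero _),
      Cardinal.mul_eq_right Cardinal.aleph0_le_continuum mk_opens_complex (Cardinal.mk_ne_zero _)]
  obtain ⟨e⟩ : Nonempty (ι ≃ TopologicalSpace.Opens ℂ × T × ℝ) :=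
    Cardinal.eq.1 (hι.trans hprod.symm)
  have hIio : ∀ i : ι, #(Iio i) < 𝔠 := fun i =>
    (Cardinal.mk_Iio_lt i (by simp [ι])).trans_eq hι
  let small : Set ℂ → Prop := fun S => ∀ x : ℝ, {y : ℝ | (⟨x, y⟩ : ℂ) ∈ S}.Countable
  -- The enumeration of open sets also lists the closed sets, as complements. Stage `i` avoids the
  -- vertical lines of earlier points and every earlier closed set with countable vertical sections.
  obtain ⟨z, hz⟩ := exists_forall_of_wellFoundedLT (ι := ι) (α := ℂ)
    (fun i g w => ((e i).1.1.Nonempty → w ∈ (e i).1) ∧ Liouville w.re ∧ ¬ Liouville w.im ∧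
      (∀ j, w.re ≠ (g j).re) ∧
      ∀ j : Iio i, small ((e j).1 : Set ℂ)ᶜ → w ∉ ((e j).1 : Set ℂ)ᶜ) (by
    intro i g
    obtain ⟨V, hV, hVne, hVU⟩ : ∃ V : Set ℂ, IsOpen V ∧ V.Nonempty ∧
        ((e i).1.1.Nonempty → V ⊆ (e i).1) := by
      by_cases h : (e i).1.1.Nonempty
      · exact ⟨(e i).1, (e i).1.isOpen, h, fun _ => subset_rfl⟩
      · exact ⟨univ, isOpen_univ, univ_nonempty, fun h' => absurd h' h⟩
    obtain ⟨w, hwV, h1, h2, h3, h4⟩ := exists_mem_open_avoiding hV hVne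
      (κ := {j : Iio i // small ((e j).1 : Set ℂ)ᶜ})
      ((Cardinal.mk_subtype_le _).trans_lt (hIio i))
      (B := range fun j => (g j).re) (Cardinal.mk_range_le.trans_lt (hIio i))
      (G := fun j => ((e j.1).1 : Set ℂ)ᶜ) (fun j => j.2)
    exact ⟨w, fun h => hVU h hwV, h1, h2, fun j hj => h3 ⟨j, hj.symm⟩, fun j hj => h4 ⟨j, hj⟩⟩)
  have hre : Function.Injective fun i => (z i).re := by
    intro i j hij
    rcases lt_trichotomy i j with h | h | h
    · exact absurd hij.symm ((hz j).2.2.2.1 ⟨i, h⟩)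
    · exact h
    · exact absurd hij ((hz i).2.2.2.1 ⟨j, h⟩)
  refine ⟨ι, z, fun i => (e i).2.1, fun i j h => hre (congrArg Complex.re h),
    fun i => ⟨(hz i).2.1, (hz i).2.2.1⟩, ?_, ?_⟩
  · intro U hU hne t
    rw [← Cardinal.mk_real]
    refine Cardinal.mk_le_of_injective
      (f := fun r : ℝ => ⟨e.symm (⟨U, hU⟩, t, r), ?_, by simp⟩) ?_
    · simpa using (hz (e.symm (⟨U, hU⟩, t, r))).1 (by simpa using hne)
    · intro r r' h
      simpa using congrArg Subtype.val h
  · intro P hP hne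
    by_cases hs : small P
    · refine hP.exists_subset_disjoint hne ?_
      obtain ⟨i, hi⟩ : ∃ i, ((e i).1 : Set ℂ)ᶜ = P :=
        ⟨e.symm (⟨Pᶜ, hP.closed.isOpen_compl⟩, Classical.arbitrary T, 0), by simp⟩
      -- Points chosen after stage `i` avoid `P`, so fewer than `𝔠` lie in it.
      have hsub : range z ∩ P ⊆ z '' Iic i := by
        rintro _ ⟨⟨j, rfl⟩, hj⟩
        refine mem_image_of_mem _ (mem_Iic.2 (not_lt.1 fun hij => ?_))
        refine (hz j).2.2.2.2 ⟨i, hij⟩ ?_ ?_ <;> simpa only [hi]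
      refine (Cardinal.mk_le_mk_of_subset hsub).trans_lt (Cardinal.mk_image_le.trans_lt ?_)
      rw [← Iio_insert, Cardinal.mk_insert self_notMem_Iio]
      exact Cardinal.add_lt_of_lt Cardinal.aleph0_le_continuum (hIio i)
        (Cardinal.one_lt_aleph0.trans Cardinal.aleph0_lt_continuum)
    -- Otherwise some vertical section of `P` is uncountable, and a vertical line contains at most
    -- one `z i`.
    · obtain ⟨x, hx⟩ : ∃ x : ℝ, ¬ {y : ℝ | (⟨x, y⟩ : ℂ) ∈ P}.Countable := by simpa [small] using hs
      have hcl : IsClosed (P ∩ Complex.re ⁻¹' {x}) :=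
        hP.closed.inter (isClosed_singleton.preimage Complex.continuous_re)
      have hunc : ¬ (P ∩ Complex.re ⁻¹' {x}).Countable := by
        refine fun hc => hx ((hc.image Complex.im).mono ?_)
        exact fun y hy => ⟨⟨x, y⟩, ⟨hy, rfl⟩, rfl⟩
      obtain ⟨Q, hQ, hQne, hQP⟩ := exists_perfect_nonempty_of_isClosed_of_not_countable hcl hunc
      have hfew : #(range z ∩ Q : Set ℂ) < 𝔠 := by
        have hss : (range z ∩ Q : Set ℂ).Subsingleton := by
          rintro _ ⟨⟨i, rfl⟩, hi⟩ _ ⟨⟨j, rfl⟩, hj⟩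
          have : (z i).re = (z j).re := (hQP hi).2.trans (hQP hj).2.symm
          rw [hre this]
        exact (Cardinal.mk_le_aleph0_iff.2 hss.countable).trans_lt Cardinal.aleph0_lt_continuum
      obtain ⟨Q', hQ', h⟩ := hQ.exists_subset_disjoint hQne hfew
      exact ⟨Q', hQ'.trans (hQP.trans inter_subset_left), h⟩

/-! ### Membership in the class -/

theorem ae_eq_zero_of_support_subset {f : ℂ → ℂ} (hf : ∀ w, f w ≠ 0 → Liouville w.re) :
    f =ᵐ[MeasureTheory.volume] 0 := by
  have hre : MeasureTheory.Measure.QuasiMeasurePreserving Complex.re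
      (MeasureTheory.volume : MeasureTheory.Measure ℂ) MeasureTheory.volume :=
    (MeasureTheory.Measure.quasiMeasurePreserving_fst (μ := (MeasureTheory.volume :
      MeasureTheory.Measure ℝ)) (ν := (MeasureTheory.volume : MeasureTheory.Measure ℝ))).comp
      Complex.volume_preserving_equiv_real_prod.quasiMeasurePreserving
  filter_upwards [hre.ae ae_not_liouville] with w hw
  by_contra h
  exact hw (hf w h)

theorem residualEq_zero_of_support_subset {f : ℂ → ℂ} (hf : ∀ w, f w ≠ 0 → ¬ Liouville w.im) :
    f =ᶠ[residual ℂ] 0 := by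
  filter_upwards [(tendsto_residual_of_isOpenMap Complex.continuous_im
    Complex.isOpenMap_im).eventually eventually_residual_liouville] with w hw
  by_contra h
  exact hf w h hw

theorem hasBaireProperty_of_residualEq_zero {f : ℂ → ℂ} (hf : f =ᶠ[residual ℂ] 0) :
    HasBaireProperty f := by
  intro U hU
  have h0 : BaireMeasurableSet ((0 : ℂ → ℂ) ⁻¹' U) :=
    (hU.preimage continuous_zero).baireMeasurableSet
  exact h0.congr (hf.symm.preimage U)

theorem StronglyEverywhereSurjective.ne_zero {f : ℂ → ℂ} (hf : StronglyEverywhereSurjective f) :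
    f ≠ 0 := by
  rintro rfl
  have := hf univ isOpen_univ univ_nonempty 1
  simp [Cardinal.continuum_ne_zero.symm] at this

/-- There is a family of functions, indexed by the sets of reals, such that every nonzero
polynomial without constant term in its members belongs to the class. -/
theorem exists_family_aeval_mem_classG :
    ∃ F : Set ℝ → (ℂ → ℂ), ∀ P : MvPolynomial (Set ℝ) ℂ, MvPolynomial.constantCoeff P = 0 →
      P ≠ 0 → MvPolynomial.aeval F P ∈ classG := by
  obtain ⟨ι, z, τ, hz, hL, hdense, hthin⟩ :=
    exists_thin_labelled_points (T := SeparatingData) mk_separatingData.le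
  let F : Set ℝ → ℂ → ℂ := fun A => Function.extend z (fun i => independentFamily A (τ i)) 0
  refine ⟨F, fun P h0 hP => ?_⟩
  have heval : ∀ w, MvPolynomial.aeval F P w = MvPolynomial.eval (fun A => F A w) P := by
    intro w
    have : (Pi.evalAlgHom ℂ (fun _ : ℂ => ℂ) w) (MvPolynomial.aeval F P) =
        MvPolynomial.eval (fun A => F A w) P := by
      rw [← AlgHom.comp_apply, MvPolynomial.comp_aeval, ← MvPolynomial.aeval_eq_eval]
      rfl
    exact this
  have hpt : ∀ i, MvPolynomial.aeval F P (z i) =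
      MvPolynomial.eval (fun A => independentFamily A (τ i)) P := by
    intro i
    rw [heval]
    simp only [F, hz.extend_apply]
  have hoff : ∀ w, w ∉ range z → MvPolynomial.aeval F P w = 0 := by
    intro w hw
    have hw' : ¬ ∃ i, z i = w := hw
    rw [heval, show (fun A => F A w) = 0 from funext fun A => Function.extend_apply' _ _ _ hw',
      MvPolynomial.eval_zero]
    exact h0
  have hsupp : ∀ w, MvPolynomial.aeval F P w ≠ 0 → Liouville w.re ∧ ¬ Liouville w.im := by
    intro w hw
    obtain ⟨i, rfl⟩ := not_imp_comm.1 (hoff w) hw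
    exact hL i
  refine ⟨?_, ?_, ?_, ?_⟩
  · intro U hU hne v
    refine le_antisymm ((Cardinal.mk_set_le _).trans_eq Cardinal.mk_complex) ?_
    obtain ⟨t, ht⟩ := exists_eval_independentFamily_eq h0 hP v
    refine (hdense U hU hne t).trans (Cardinal.mk_le_of_injective
      (f := fun i => ⟨z i.1, i.2.1, by rw [hpt, i.2.2, ht]⟩) ?_)
    intro i j hij
    exact Subtype.ext (hz (congrArg Subtype.val hij))
  · intro S hS hne
    obtain ⟨Q, hQS, hQ, hQne, hd⟩ := hthin S hS hne
    exact ⟨Q, hQS, hQ, hQne, fun w hw => hoff w (disjoint_left.1 hd hw)⟩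
  · exact (aemeasurable_zero.congr
      (ae_eq_zero_of_support_subset fun w hw => (hsupp w hw).1).symm).nullMeasurable
  · exact hasBaireProperty_of_residualEq_zero
      (residualEq_zero_of_support_subset fun w hw => (hsupp w hw).2)

/-- Elements of a non-unital adjoin are values of polynomials without constant term. -/
theorem NonUnitalAlgebra.exists_aeval_eq_of_mem_adjoin_range {K A σ : Type*} [Field K] [CommRing A]
    [Algebra K A] {F : σ → A} {x : A} (hx : x ∈ NonUnitalAlgebra.adjoin K (range F)) :
    ∃ P : MvPolynomial σ K, MvPolynomial.constantCoeff P = 0 ∧ MvPolynomial.aeval F P = x := by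
  induction hx using NonUnitalAlgebra.adjoin_induction with
  | mem x hx =>
    obtain ⟨i, rfl⟩ := hx
    exact ⟨MvPolynomial.X i, by simp, by simp⟩
  | add x y _ _ hx hy =>
    obtain ⟨P, hP, rfl⟩ := hx
    obtain ⟨Q, hQ, rfl⟩ := hy
    exact ⟨P + Q, by simp [hP, hQ], by simp⟩
  | zero => exact ⟨0, by simp, by simp⟩
  | mul x y _ _ hx hy =>
    obtain ⟨P, hP, rfl⟩ := hx
    obtain ⟨Q, hQ, rfl⟩ := hy
    exact ⟨P * Q, by simp [hP], by simp⟩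
  | smul r x _ hx =>
    obtain ⟨P, hP, rfl⟩ := hx
    exact ⟨r • P, by simp [hP], by simp⟩

theorem stronglyAlgebrable_classG :
    StronglyAlgebrable ℂ ((2 : Cardinal.{0}) ^ Cardinal.continuum.{0}) classG := by
  obtain ⟨F, hF⟩ := exists_family_aeval_mem_classG
  have hinj : Function.Injective F := by
    intro A B hAB
    by_contra hne
    have hX : (MvPolynomial.X A - MvPolynomial.X B : MvPolynomial (Set ℝ) ℂ) ≠ 0 :=
      sub_ne_zero.2 fun h => hne (MvPolynomial.X_injective h)
    exact (hF _ (by simp) hX).1.ne_zero (by simp [hAB])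
  refine ⟨range F, ?_, ?_, ?_⟩
  · rw [Cardinal.mk_range_eq F hinj, Cardinal.mk_set, Cardinal.mk_real]
  · intro P h0 hP
    by_contra hne
    -- Reindexes the variables by sets of reals, where `hF` applies.
    let e := (Equiv.ofInjective F hinj).symm
    refine (hF (MvPolynomial.rename e P) (by simpa using h0) ?_).1.ne_zero ?_
    · exact fun h => hne (MvPolynomial.rename_injective _ e.injective (by simpa using h))
    · rw [MvPolynomial.aeval_rename, ← hP]
      congr 2
      funext x
      exact congrArg Subtype.val ((Equiv.ofInjective F hinj).apply_symm_apply x)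
  · intro x hx
    obtain ⟨P, h0, rfl⟩ := NonUnitalAlgebra.exists_aeval_eq_of_mem_adjoin_range hx
    by_cases hP : P = 0
    · exact Or.inr (by simp [hP])
    · exact Or.inl (hF P h0 hP)

theorem mainTheorem8 :
    (∀ f : ℂ → ℂ, VanishesPerfectly f → MarczewskiMeasurable f) ∧
      StronglyAlgebrable ℂ ((2 : Cardinal.{0}) ^ Cardinal.continuum.{0}) classG := by
  exact ⟨fun _ hf => hf.marczewskiMeasurable, stronglyAlgebrable_classG⟩
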